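/- **Setting.** Let $(X_\ell)_{\ell\in\mathbb N}$ be nonempty finite state spaces with $n_\ell=|X_\ell|\to\infty$ and let $(K_\ell)$ be nonempty finite key spaces. "Polynomial" and "negligible" refer to $\log n_\ell$: $q_\ell$ is polynomially bounded if $q_\ell\le(\log n_\ell)^c$ for some $c$ and all large $\ell$, and $\varepsilon_\ell$ is negligible if for every $c$, $\varepsilon_\ell\le(\log n_\ell)^{-c}$ for all large $\ell$. Below, the index $\ell$ is suppressed. Let $\star: X\times\mathbb Z/n\to X$ and $\oplus: X\times X\to X$ be Latin square operations (uniquely invertible given the output and one of the inputs), for instance addition modulo $n$ and bitwise XOR. For $h:X\to X$ let $D_h(L,R)=(R,\,L\oplus h(R))$ be the Feistel permutation. For $f:X\to X$ and a seed $x_0\in X$, the two-step counter-assisted generator has states $s_i=(x_{2i},x_{2i+1})$, $i\ge 0$, where $$x_{2i+1}=f(x_{2i})\star (i \bmod n),\qquad x_{2i+2}=f(x_{2i+1}).$$ Let $k\mapsto g_k$, $k\in K$, be a keyed family of functions $X\to X$, and let $(k_1,k_2,k_3)$ be a random element of $K^3$ with an arbitrary joint distribution. The $i$th output is $y_i=\big(D_{g_{k_1}}\circ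 D_{g_{k_2}}\circ D_{g_{k_3}}\big)(s_i)$. A random object is *pseudorandom* against a class of adversaries if no adversary in the class (a sequence, one for each $\ell$) distinguishes it from a uniformly random object of the same kind with non-negligible advantage. For $k\mapsto g_k$ this means: $g_k$ with uniform $k\in K$ versus a uniformly random function $X\to X$, where the adversary adaptively queries the function. For the keys: $(k_1,k_2,k_3)$ versus a uniform element of $K^3$. For the output: for every polynomially bounded $q$, $(y_0,\dots,y_{q-1})$ versus a uniform element of $(X\times X)^q$. **Theorem.** Assume that $k\mapsto g_k$ is pseudorandom and that the keys $(k_1,k_2,k_3)$ are pseudorandom. Then for all iteration functions $f:X\to X$ and all seeds $x_0\in X$ the two-step generator has pseudorandom output. This holds in each of the following two senses of pseudorandomness, where the same sense is used in hypotheses and conclusion. 1. The adversaries have unlimited computational power; those attacking $k\mapsto g_k$ may make polynomially many queries. 2. The adversaries are (non-uniform) Boolean circuits of polynomial size, with oracle gates when attacking $k\mapsto g_k$. Here the elements of $X$ and of $K$ are given by pairwise different bit strings of polynomially bounded length (one length for each of $X_\ell$, $K_\ell$), and $(k,x)\mapsto g_k(x)$ and $\oplus$ are assumed to be computable by circuits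 of polynomial size; no efficiency is required of $f$ or $\star$. -/

import Mathlib

open Filter

/-! ### Asymptotics in `log n`, where `n l` is the size of the `l`-th state space -/

/-- `q` is bounded by a polynomial in `log n`. -/
def PolyBounded (n q : ℕ → ℕ) : Prop :=
  ∃ c : ℕ, ∀ᶠ l in atTop, (q l : ℝ) ≤ Real.log (n l) ^ c

/-- `ε` tends to zero faster than every inverse power of `log n`. -/
def Negligible (n : ℕ → ℕ) (ε : ℕ → ℝ) : Prop :=
  ∀ c : ℕ, ∀ᶠ l in atTop, ε l ≤ 1 / Real.log (n l) ^ c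

/-! ### Indistinguishability -/

/-- The probability that the test `T` accepts a sample of `P`. -/
noncomputable def acceptProb {α : Type*} (P : PMF α) (T : α → Bool) : ℝ :=
  (P.map T true).toReal

/-- No (sequence of) tests in the class `𝒯` tells `P` from `Q` with a non-negligible advantage. -/
def Indistinguishable (n : ℕ → ℕ) {α : ℕ → Type*} (𝒯 : Set (∀ l, α l → Bool))
    (P Q : ∀ l, PMF (α l)) : Prop :=
  ∀ T ∈ 𝒯, Negligible n fun l => |acceptProb (P l) (T l) - acceptProb (Q l) (T l)|

/-- The members of the family `P` are indistinguishable from uniformly random ones. -/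
def Pseudorandom (n : ℕ → ℕ) {α : ℕ → Type*} [∀ l, Fintype (α l)] [∀ l, Nonempty (α l)]
    (𝒯 : Set (∀ l, α l → Bool)) (P : ∀ l, PMF (α l)) : Prop :=
  Indistinguishable n 𝒯 P fun l => PMF.uniformOfFintype (α l)

/-! ### Adversaries of unlimited computational power -/

/-- An algorithm without any bound on its computations, which adaptively asks for values of an
unknown function `A → B` and then outputs a bit. (Coins are not needed: the best fixed values of the
coins do at least as well as random ones.) -/
inductive QueryAlg (A B : Type*) where
  | output (b : Bool) : QueryAlg A B
  | query (a : A) (next : B → QueryAlg A B) : QueryAlg A B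

namespace QueryAlg

variable {A B : Type*}

/-- The output of the algorithm when its queries are answered by `h`. -/
def run (h : A → B) : QueryAlg A B → Bool
  | output b => b
  | query a next => (next (h a)).run h

/-- Whatever the answers are, the algorithm makes at most the given number of queries. -/
def QueriesAtMost : QueryAlg A B → ℕ → Prop
  | output _, _ => True
  | query _ _, 0 => False
  | query _ next, q + 1 => ∀ b, (next b).QueriesAtMost q

end QueryAlg

/-- Tests of functions that use polynomially (in `log n`) many values of the function. -/
def queryTests (n : ℕ → ℕ) (X : ℕ → Type*) : Set (∀ l, (X l → X l) → Bool) :=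
  {T | ∃ q : ℕ → ℕ, PolyBounded n q ∧ ∃ A : ∀ l, QueryAlg (X l) (X l),
    ∀ l, (A l).QueriesAtMost (q l) ∧ ∀ h, T l h = (A l).run h}

/-! ### Boolean circuits, possibly with oracle gates -/

/-- The gates of a circuit. Wires are numbered in the order in which they are created, the input
wires first. A constant gate or a NAND gate creates one wire; an oracle gate sends the string on the
wires listed in `src` to the oracle and creates one wire for every bit of the answer. -/
inductive Gate where
  | const (b : Bool) : Gate
  | nand (i j : ℕ) : Gate
  | query (src : List ℕ) : Gate

/-- The bit on wire `i`; wires that do not exist carry `false`. -/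
def wire (w : List Bool) (i : ℕ) : Bool := w.getD i false

namespace Gate

/-- The bits on the new wires. -/
def eval (O : List Bool → List Bool) (w : List Bool) : Gate → List Bool
  | const b => [b]
  | nand i j => [!(wire w i && wire w j)]
  | query src => O (src.map (wire w))

def size : Gate → ℕ
  | const _ => 1
  | nand _ _ => 1
  | query src => src.length + 1

end Gate

structure Circuit where
  /-- The gates, in the order of evaluation. -/
  gates : List Gate
  /-- The output wires. -/
  out : List ℕ

namespace Circuit

def size (C : Circuit) : ℕ := (C.gates.map Gate.size).sum + C.out.length

/-- The output of the circuit on the input `w`, with oracle `O`. -/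
def evalWith (O : List Bool → List Bool) (C : Circuit) (w : List Bool) : List Bool :=
  C.out.map (wire (C.gates.foldl (fun v G => v ++ G.eval O v) w))

/-- The output of the circuit without an oracle (oracle gates are then void). -/
def eval (C : Circuit) (w : List Bool) : List Bool := C.evalWith (fun _ => []) w

end Circuit

/-- An encoding of the elements of `X` by pairwise different bit strings of one length. -/
structure BitEncoding (X : Type*) where
  len : ℕ
  code : X → List Bool
  length_code : ∀ x, (code x).length = len
  code_injective : Function.Injective code

namespace BitEncoding

variable {X : Type*}

/-- A function `h : X → X` as an oracle on bit strings; strings that encode no element of `X` are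
answered by zeros. -/
noncomputable def oracle (e : BitEncoding X) (h : X → X) : List Bool → List Bool :=
  Function.extend e.code (fun x => e.code (h x)) fun _ => List.replicate e.len false

def pairCode (e : BitEncoding X) (p : X × X) : List Bool := e.code p.1 ++ e.code p.2

def tripleCode (e : BitEncoding X) (p : X × X × X) : List Bool :=
  e.code p.1 ++ (e.code p.2.1 ++ e.code p.2.2)

/-- The code of a finite sequence of pairs is the concatenation of the codes of its entries. -/
def pairSeqCode (e : BitEncoding X) {q : ℕ} (y : Fin q → X × X) : List Bool :=
  (List.ofFn y).flatMap e.pairCode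

end BitEncoding

/-- A two-argument function is computed, in terms of encodings, by circuits of size polynomial
in `log n`. -/
def EfficientlyComputable (n : ℕ → ℕ) {A B C : ℕ → Type*} (eA : ∀ l, BitEncoding (A l))
    (eB : ∀ l, BitEncoding (B l)) (eC : ∀ l, BitEncoding (C l))
    (F : ∀ l, A l → B l → C l) : Prop :=
  ∃ E : ℕ → Circuit, PolyBounded n (fun l => (E l).size) ∧
    ∀ l a b, (E l).eval ((eA l).code a ++ (eB l).code b) = (eC l).code (F l a b)

/-- Tests of functions by oracle circuits of size polynomial in `log n`. -/
def oracleCircuitTests (n : ℕ → ℕ) {X : ℕ → Type*} (e : ∀ l, BitEncoding (X l)) :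
    Set (∀ l, (X l → X l) → Bool) :=
  {T | ∃ E : ℕ → Circuit, PolyBounded n (fun l => (E l).size) ∧
    ∀ l h, T l h = decide ((E l).evalWith ((e l).oracle h) [] = [true])}

/-- Tests of single elements, given by their codes, by circuits of size polynomial in `log n`. -/
def circuitTests (n : ℕ → ℕ) {α : ℕ → Type*} (code : ∀ l, α l → List Bool) :
    Set (∀ l, α l → Bool) :=
  {T | ∃ E : ℕ → Circuit, PolyBounded n (fun l => (E l).size) ∧
    ∀ l a, T l a = decide ((E l).eval (code l a) = [true])}

/-! ### The two-step generator with a Feistel output function -/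

/-- A Latin square operation: uniquely invertible given its output and any one of its inputs. -/
def IsLatinSquare {A B C : Type*} (op : A → B → C) : Prop :=
  (∀ a, Function.Bijective fun b => op a b) ∧ ∀ b, Function.Bijective fun a => op a b

/-- The Feistel permutation `(L, R) ↦ (R, L ⊕ g R)`, with any operation in the place of `⊕`. -/
def feistel {X : Type*} (xor : X → X → X) (g : X → X) (p : X × X) : X × X :=
  (p.2, xor p.1 (g p.2))

/-- The two-step iteration function `f̂ (a, b) = (f b, f (f b))`. -/
def twoStep {X : Type*} (f : X → X) (p : X × X) : X × X := (f p.2, f (f p.2))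

/-- The two-step counter operation `(a, b) ⋆̂ i = (a, b ⋆ i)`. -/
def starHat {X N : Type*} (star : X → N → X) (p : X × X) (i : N) : X × X := (p.1, star p.2 i)

/-- The states of the two-step counter-assisted generator with seed `x₀` and a cyclic counter modulo
`n = |X|`, that is, the pairs `(x₂ᵢ, x₂ᵢ₊₁)` with `x₂ᵢ₊₁ = f x₂ᵢ ⋆ i` and `x₂ᵢ₊₂ = f x₂ᵢ₊₁`. -/
def twoStepState {X : Type*} [Fintype X] (star : X → ZMod (Fintype.card X) → X) (f : X → X)
    (x₀ : X) : ℕ → X × X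
  | 0 => starHat star (x₀, f x₀) 0
  | i + 1 => starHat star (twoStep f (twoStepState star f x₀ i)) ((i + 1 : ℕ) : ZMod _)

/-- The first `q` outputs of the two-step generator with output function
`D_{g k₁} ∘ D_{g k₂} ∘ D_{g k₃}`. -/
def twoStepOutputs {X K : Type*} [Fintype X] (star : X → ZMod (Fintype.card X) → X)
    (xor : X → X → X) (g : K → X → X) (f : X → X) (x₀ : X) (q : ℕ) (k : K × K × K) :
    Fin q → X × X :=
  fun i => (feistel xor (g k.1) ∘ feistel xor (g k.2.1) ∘ feistel xor (g k.2.2))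
    (twoStepState star f x₀ i)

/-!
The proof is a hybrid argument followed by the analysis of three Feistel rounds with random
functions (Luby and Rackoff).

*Hybrids* (`negligible_advantage_twoStepOutputs`). The keys are replaced by uniform ones. Then the
functions `g k₃`, `g k₂`, `g k₁` are replaced by random functions, in the order in which they are
applied to the states. A distinguisher for one of these replacements yields an adversary against `g`,
for which the other two functions are fixed at the choice that maximizes the advantage. Because of
the order, the functions that are already random, and hence may be infeasible to compute, act before
the unknown function. The points at which they are needed are known beforehand, so their values can
be hard-wired into a nonuniform adversary, the unknown function is queried only at constants, and
what remains to be computed involves only `g` with fixed keys and `⊕`. Nothing about `f` or `⋆`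
needs to be computed, as the states are constants, too.

*Random functions* (`abs_expect_feistelOutputs_sub_le`). If the inputs are pairwise different, then
the right halves after the first round collide with probability at most `q ^ 2 / n`. Without a
collision there, the right halves after the second round are independent and uniform, and they
collide with probability at most `q ^ 2 / n`; without a collision there, the remaining halves of the
outputs are independent and uniform, too. The states of the generator are pairwise different during
the first `n` steps by `injective_twoStepState`, which is what the counter is for.

*Circuits*. The adversaries of polynomial size are put together with the help of the predicate
`ComputableInSize`, which is closed under concatenation, oracle calls and the application of
circuits, so that no wire has to be numbered by hand outside of the proofs of these closure
properties.
-/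

/-! ### Composition of circuits -/

namespace Gate

/-- The wires after the evaluation of a list of gates, starting from the wires `w`. -/
def run (O : List Bool → List Bool) (gs : List Gate) (w : List Bool) : List Bool :=
  gs.foldl (fun v G => v ++ G.eval O v) w

theorem run_cons (O : List Bool → List Bool) (G : Gate) (gs : List Gate) (w : List Bool) :
    run O (G :: gs) w = run O gs (w ++ G.eval O w) := rfl

theorem run_append (O : List Bool → List Bool) (gs gs' : List Gate) (w : List Bool) :
    run O (gs ++ gs') w = run O gs' (run O gs w) := List.foldl_append

theorem prefix_run (O : List Bool → List Bool) (gs : List Gate) (w : List Bool) :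
    w <+: run O gs w := by
  induction gs generalizing w with
  | nil => exact List.prefix_rfl
  | cons G gs ih => exact (List.prefix_append w _).trans (ih _)

end Gate

theorem wire_append_left {w : List Bool} {i : ℕ} (hi : i < w.length) (v : List Bool) :
    wire (w ++ v) i = wire w i := List.getD_append _ _ _ _ hi

theorem wire_append_right (w v : List Bool) (i : ℕ) : wire (w ++ v) (w.length + i) = wire v i := by
  rw [wire, List.getD_append_right _ _ _ _ (Nat.le_add_right _ _), Nat.add_sub_cancel_left, wire]

theorem map_wire_append {w : List Bool} {out : List ℕ} (h : ∀ i ∈ out, i < w.length)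
    (v : List Bool) : out.map (wire (w ++ v)) = out.map (wire w) :=
  List.map_congr_left fun i hi => wire_append_left (h i hi) v

theorem map_wire_of_prefix {w w' : List Bool} (hw : w <+: w') {out : List ℕ}
    (h : ∀ i ∈ out, i < w.length) : out.map (wire w') = out.map (wire w) := by
  obtain ⟨v, rfl⟩ := hw
  exact map_wire_append h v

theorem map_wire_range' (u v w : List Bool) :
    (List.range' u.length v.length).map (wire (u ++ v ++ w)) = v := by
  apply List.ext_getElem
  · simp
  · intro i h1 h2
    simp only [List.getElem_map, List.getElem_range', one_mul, List.append_assoc]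
    rw [wire_append_right, wire_append_left h2]
    simp [wire, h2]

/-- The family `F` of bit strings can be produced by gates of total size at most `s` in a setting
where in each situation `ω` the oracle is `O ω` and the bits `I ω` are given on the first wires.
The gates may be placed after any gates that are already there, whence the quantification over the
present wires `W`. The result is read off the wires listed in `out`, which are required to exist, so
that gates placed later do not change it. -/
def ComputableInSize {Ω : Type*} (O : Ω → List Bool → List Bool) (I : Ω → List Bool) (s : ℕ)
    (F : Ω → List Bool) : Prop :=
  ∀ (W : Ω → List Bool) (N : ℕ), (∀ ω, (W ω).length = N) → (∀ ω, I ω <+: W ω) →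
    ∃ (gs : List Gate) (out : List ℕ) (M : ℕ), (gs.map Gate.size).sum ≤ s ∧
      (∀ ω, (Gate.run (O ω) gs (W ω)).length = M) ∧ (∀ i ∈ out, i < M) ∧
      ∀ ω, out.map (wire (Gate.run (O ω) gs (W ω))) = F ω

namespace Gate

/-- The wire numbers of a circuit with `src.length` inputs after its transfer into a larger circuit:
the inputs are at the places listed in `src`, and the new wires start at `b`. -/
def relocIndex (src : List ℕ) (b i : ℕ) : ℕ :=
  if i < src.length then src.getD i 0 else b + (i - src.length)

/-- A gate with renumbered wires. Oracle gates are dropped, as is appropriate for a circuit that is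
meant to be used without an oracle: with the void oracle they create no wires. -/
def reloc (src : List ℕ) (b : ℕ) : Gate → List Gate
  | const c => [const c]
  | nand i j => [nand (relocIndex src b i) (relocIndex src b j)]
  | query _ => []

theorem sum_size_reloc_le (src : List ℕ) (b : ℕ) (gs : List Gate) :
    ((gs.flatMap (reloc src b)).map size).sum ≤ (gs.map size).sum := by
  induction gs with
  | nil => simp
  | cons G gs ih =>
    have : ((reloc src b G).map size).sum ≤ G.size := by cases G <;> simp [reloc, size]
    simp only [List.flatMap_cons, List.map_append, List.sum_append, List.map_cons, List.sum_cons]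
    omega

theorem wire_relocIndex (v ext : List Bool) (src : List ℕ) (hsrc : ∀ i ∈ src, i < v.length)
    (i : ℕ) :
    wire (v ++ ext) (relocIndex src v.length i) = wire (src.map (wire v) ++ ext) i := by
  unfold relocIndex
  split_ifs with h
  · have : src.getD i 0 = src[i] := by simp [h]
    rw [this, wire_append_left (hsrc _ (List.getElem_mem h)),
      wire_append_left (by simpa using h)]
    simp [wire, h]
  · obtain ⟨j, rfl⟩ := Nat.exists_eq_add_of_le (not_lt.mp h)
    rw [Nat.add_sub_cancel_left, wire_append_right]
    conv_rhs => rw [← List.length_map (as := src) (wire v), wire_append_right]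

/-- A relocated circuit creates the same new wires as the original one does with the void oracle. -/
theorem run_reloc (O : List Bool → List Bool) (v : List Bool) (src : List ℕ)
    (hsrc : ∀ i ∈ src, i < v.length) (gs : List Gate) (ext : List Bool) :
    ∃ ext', run (fun _ => []) gs (src.map (wire v) ++ ext) = src.map (wire v) ++ ext' ∧
      run O (gs.flatMap (reloc src v.length)) (v ++ ext) = v ++ ext' ∧
      ext'.length = ext.length + (gs.flatMap (reloc src v.length)).length := by
  induction gs generalizing ext with
  | nil => exact ⟨ext, rfl, rfl, rfl⟩
  | cons G gs ih =>
    cases G with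
    | const c =>
      obtain ⟨e, h1, h2, h3⟩ := ih (ext ++ [c])
      refine ⟨e, ?_, ?_, ?_⟩
      · rw [← h1, run_cons]; simp [eval]
      · rw [← h2]
        simp only [List.flatMap_cons, reloc, List.singleton_append, run_cons]
        simp [eval]
      · rw [h3]; simp [reloc]; omega
    | nand i j =>
      obtain ⟨e, h1, h2, h3⟩ := ih
        (ext ++ [!(wire (src.map (wire v) ++ ext) i && wire (src.map (wire v) ++ ext) j)])
      refine ⟨e, ?_, ?_, ?_⟩
      · rw [← h1, run_cons]; simp [eval]
      · rw [← h2]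
        simp only [List.flatMap_cons, reloc, List.singleton_append, run_cons]
        simp [eval, wire_relocIndex v ext src hsrc]
      · rw [h3]; simp [reloc]; omega
    | query l =>
      obtain ⟨e, h1, h2, h3⟩ := ih ext
      refine ⟨e, ?_, ?_, ?_⟩
      · rw [← h1, run_cons]; simp [eval]
      · rw [← h2]; simp [reloc]
      · rw [h3]; simp [reloc]

end Gate

namespace ComputableInSize

variable {Ω : Type*} {O : Ω → List Bool → List Bool} {I : Ω → List Bool} {s t : ℕ}
  {F G : Ω → List Bool}

theorem mono (h : ComputableInSize O I s F) (hst : s ≤ t) : ComputableInSize O I t F := by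
  intro W N hN hI
  obtain ⟨gs, out, M, h1, h2⟩ := h W N hN hI
  exact ⟨gs, out, M, h1.trans hst, h2⟩

theorem const (b : List Bool) : ComputableInSize O I b.length fun _ => b := by
  intro W N hN hI
  have key : ∀ (O : List Bool → List Bool) (w : List Bool),
      Gate.run O (b.map Gate.const) w = w ++ b := by
    intro O w
    induction b generalizing w with
    | nil => simp [Gate.run]
    | cons c b ih => simp [Gate.run_cons, ih, Gate.eval]
  refine ⟨b.map Gate.const, List.range' N b.length, N + b.length, ?_, ?_, ?_, ?_⟩
  · have : Gate.size ∘ Gate.const = fun _ => 1 := rfl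
    simp [this]
  · intro ω; simp [key, hN]
  · intro i hi; simp at hi; omega
  · intro ω
    rw [key, ← hN ω]
    simpa using map_wire_range' (W ω) b []

/-- A segment of the input, at a place that does not depend on the input, costs nothing. -/
theorem input {a b c : Ω → List Bool} (hI : ∀ ω, I ω = a ω ++ b ω ++ c ω) {A B : ℕ}
    (ha : ∀ ω, (a ω).length = A) (hb : ∀ ω, (b ω).length = B) : ComputableInSize O I 0 b := by
  intro W N hN hW
  rcases isEmpty_or_nonempty Ω with hΩ | ⟨⟨ω₀⟩⟩
  · exact ⟨[], [], 0, by simp, fun ω => hΩ.elim ω, by simp, fun ω => hΩ.elim ω⟩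
  refine ⟨[], List.range' A B, N, by simp, hN, ?_, ?_⟩
  · intro i hi
    have := (hW ω₀).length_le
    rw [hI, hN] at this
    simp [ha, hb] at this hi
    omega
  · intro ω
    obtain ⟨v, hv⟩ := hW ω
    have := map_wire_range' (a ω) (b ω) (c ω ++ v)
    rw [ha, hb] at this
    simp only [Gate.run, List.foldl_nil]
    rw [← hv, hI, List.append_assoc (a ω ++ b ω)]
    exact this

theorem append (hF : ComputableInSize O I s F) (hG : ComputableInSize O I t G) :
    ComputableInSize O I (s + t) fun ω => F ω ++ G ω := by
  intro W N hN hI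
  obtain ⟨gs, out, M, h1, h2, h3, h4⟩ := hF W N hN hI
  obtain ⟨gs', out', M', h1', h2', h3', h4'⟩ := hG (fun ω => Gate.run (O ω) gs (W ω)) M h2
    fun ω => (hI ω).trans (Gate.prefix_run _ _ _)
  have hle : ∀ ω, M ≤ M' := fun ω => by
    rw [← h2 ω, ← h2' ω]; exact (Gate.prefix_run _ _ _).length_le
  rcases isEmpty_or_nonempty Ω with hΩ | ⟨⟨ω₀⟩⟩
  · exact ⟨[], [], 0, by simp, fun ω => hΩ.elim ω, by simp, fun ω => hΩ.elim ω⟩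
  refine ⟨gs ++ gs', out ++ out', M', by simp; omega, ?_, ?_, ?_⟩
  · intro ω; rw [Gate.run_append]; exact h2' ω
  · intro i hi
    rcases List.mem_append.1 hi with hi | hi
    · exact (h3 i hi).trans_le (hle ω₀)
    · exact h3' i hi
  · intro ω
    rw [Gate.run_append, List.map_append, h4' ω,
      map_wire_of_prefix (Gate.prefix_run _ _ _) (fun i hi => (h2 ω).symm ▸ h3 i hi), h4 ω]

theorem flatten_ofFn {q : ℕ} {F : Fin q → Ω → List Bool}
    (hF : ∀ i, ComputableInSize O I s (F i)) :
    ComputableInSize O I (q * s) fun ω => (List.ofFn fun i => F i ω).flatten := by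
  induction q with
  | zero => simpa using const (O := O) (I := I) []
  | succ q ih =>
    have := (hF 0).append (ih fun i => hF i.succ)
    simp only [List.ofFn_succ, List.flatten_cons]
    exact this.mono (by rw [add_mul, one_mul, add_comm])

theorem query (hF : ComputableInSize O I s F) {m m' : ℕ} (hm : ∀ ω, (F ω).length = m)
    (hm' : ∀ ω, (O ω (F ω)).length = m') :
    ComputableInSize O I (s + m + 1) fun ω => O ω (F ω) := by
  intro W N hN hI
  rcases isEmpty_or_nonempty Ω with hΩ | ⟨⟨ω₀⟩⟩
  · exact ⟨[], [], 0, by simp, fun ω => hΩ.elim ω, by simp, fun ω => hΩ.elim ω⟩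
  obtain ⟨gs, out, M, h1, h2, h3, h4⟩ := hF W N hN hI
  have hrun : ∀ ω, Gate.run (O ω) (gs ++ [Gate.query out]) (W ω) =
      Gate.run (O ω) gs (W ω) ++ O ω (F ω) := by
    intro ω
    rw [Gate.run_append, Gate.run_cons, Gate.eval, h4]
    rfl
  have hout : out.length = m := by rw [← hm ω₀, ← h4 ω₀, List.length_map]
  refine ⟨gs ++ [Gate.query out], List.range' M m', M + m', ?_, ?_, ?_, ?_⟩
  · simp [Gate.size, hout]; omega
  · intro ω; simp [hrun, h2, hm']
  · intro i hi; simp at hi; omega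
  · intro ω
    rw [hrun, ← h2 ω, ← hm' ω]
    simpa using map_wire_range' (Gate.run (O ω) gs (W ω)) (O ω (F ω)) []

theorem circuit (hF : ComputableInSize O I s F) (C : Circuit) :
    ComputableInSize O I (s + C.size + 1) fun ω => C.eval (F ω) := by
  intro W N hN hI
  obtain ⟨gs, out, M, h1, h2, h3, h4⟩ := hF W N hN hI
  -- Outputs of `C` on wires that do not exist are read off a wire with the constant `false`,
  -- which is placed at `M`; the new wires of `C` start at `M + 1`.
  set gs' := C.gates.flatMap (Gate.reloc out (M + 1)) with hgs'
  have key : ∀ ω, ∃ ext, Gate.run (fun _ => []) C.gates (F ω) = F ω ++ ext ∧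
      Gate.run (O ω) (gs ++ (Gate.const false :: gs')) (W ω) =
        Gate.run (O ω) gs (W ω) ++ [false] ++ ext ∧ ext.length = gs'.length := by
    intro ω
    have hlen : (Gate.run (O ω) gs (W ω) ++ [false]).length = M + 1 := by simp [h2]
    have hmap : out.map (wire (Gate.run (O ω) gs (W ω) ++ [false])) = F ω := by
      rw [map_wire_append (fun i hi => (h2 ω).symm ▸ h3 i hi), h4]
    obtain ⟨ext, e1, e2, e3⟩ := Gate.run_reloc (O ω) (Gate.run (O ω) gs (W ω) ++ [false]) out
      (fun i hi => by rw [hlen]; exact (h3 i hi).trans (Nat.lt_succ_self _)) C.gates []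
    rw [hlen] at e2 e3
    rw [hmap] at e1
    refine ⟨ext, by simpa using e1, ?_, by rw [e3]; exact Nat.zero_add _⟩
    rw [Gate.run_append, Gate.run_cons]
    simpa [Gate.eval] using e2
  refine ⟨gs ++ (Gate.const false :: gs'), C.out.map fun i =>
      if i < out.length + gs'.length then Gate.relocIndex out (M + 1) i else M,
    M + 1 + gs'.length, ?_, ?_, ?_, ?_⟩
  · have := Gate.sum_size_reloc_le out (M + 1) C.gates
    rw [← hgs'] at this
    simp only [List.map_append, List.map_cons, List.sum_append, List.sum_cons, Circuit.size,
      Gate.size]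
    omega
  · intro ω
    obtain ⟨ext, -, e2, e3⟩ := key ω
    simp [e2, e3, h2]
    omega
  · intro i hi
    obtain ⟨j, -, rfl⟩ := List.mem_map.1 hi
    split_ifs with hj
    · unfold Gate.relocIndex
      split_ifs with hj'
      · have : out.getD j 0 = out[j] := by simp [hj']
        have := h3 _ (List.getElem_mem hj')
        omega
      · omega
    · omega
  · intro ω
    obtain ⟨ext, e1, e2, e3⟩ := key ω
    have hlen : (Gate.run (O ω) gs (W ω) ++ [false]).length = M + 1 := by simp [h2]
    have hmap : out.map (wire (Gate.run (O ω) gs (W ω) ++ [false])) = F ω := by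
      rw [map_wire_append (fun i hi => (h2 ω).symm ▸ h3 i hi), h4]
    have hFl : (F ω).length = out.length := by rw [← h4 ω, List.length_map]
    change _ = C.out.map (wire (Gate.run (fun _ => []) C.gates (F ω)))
    rw [e1, e2, List.map_map]
    refine List.map_congr_left fun i _ => ?_
    simp only [Function.comp]
    split_ifs with hi
    · have := Gate.wire_relocIndex (Gate.run (O ω) gs (W ω) ++ [false]) ext out
        (fun i hi => by rw [hlen]; exact (h3 i hi).trans (Nat.lt_succ_self _)) i
      rwa [hlen, hmap] at this
    · have : wire (Gate.run (O ω) gs (W ω) ++ [false] ++ ext) M = false := by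
        rw [wire_append_left (by omega), ← h2 ω]
        simp [wire]
      rw [this]
      simp only [wire]
      rw [List.getD_eq_default]
      simp; omega

theorem exists_circuit [Nonempty Ω] (hF : ComputableInSize O I s F) {N m : ℕ}
    (hI : ∀ ω, (I ω).length = N) (hm : ∀ ω, (F ω).length = m) :
    ∃ C : Circuit, C.size ≤ s + m ∧ ∀ ω, C.evalWith (O ω) (I ω) = F ω := by
  obtain ⟨gs, out, M, h1, h2, h3, h4⟩ := hF I N hI fun _ => List.prefix_rfl
  refine ⟨⟨gs, out⟩, ?_, h4⟩
  obtain ⟨ω⟩ := ‹Nonempty Ω›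
  have : out.length = m := by rw [← hm ω, ← h4 ω, List.length_map]
  simp only [Circuit.size]
  omega

end ComputableInSize

/-! ### Acceptance probabilities as averages -/

section Expectation

open Finset BigOperators

/-- The value `1` or `0` of a bit, as a real number. -/
def bitValue (b : Bool) : ℝ := if b then 1 else 0

theorem bitValue_nonneg (b : Bool) : 0 ≤ bitValue b := by cases b <;> simp [bitValue]

theorem bitValue_le_one (b : Bool) : bitValue b ≤ 1 := by cases b <;> simp [bitValue]

theorem acceptProb_map {α β : Type*} (P : PMF α) (φ : α → β) (T : β → Bool) :
    acceptProb (P.map φ) T = acceptProb P (T ∘ φ) := by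
  rw [acceptProb, acceptProb, PMF.map_comp]

theorem acceptProb_uniformOfFintype {α : Type*} [Fintype α] [Nonempty α] (T : α → Bool) :
    acceptProb (PMF.uniformOfFintype α) T = 𝔼 x, bitValue (T x) := by
  rw [acceptProb, PMF.map_apply, tsum_fintype, ENNReal.toReal_sum (by
    intro a _; split_ifs <;> simp), Fintype.expect_eq_sum_div_card,
    Finset.sum_div]
  refine Finset.sum_congr rfl fun a _ => ?_
  cases h : T a <;> simp [bitValue]

theorem abs_expect_sub_expect_le {ι : Type*} [Fintype ι] (F G : ι → ℝ) :
    |𝔼 i, F i - 𝔼 i, G i| ≤ 𝔼 i, |F i - G i| := by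
  rw [← Finset.expect_sub_distrib]
  exact Finset.abs_expect_le _ _

/-- Averages differ at most as much as the averaged quantities do for the worst index. -/
theorem exists_abs_expect_sub_expect_le {ι : Type*} [Fintype ι] [Nonempty ι] (F G : ι → ℝ) :
    ∃ i, |𝔼 i, F i - 𝔼 i, G i| ≤ |F i - G i| := by
  obtain ⟨i, -, hi⟩ := Finset.exists_le_of_le_expect (s := Finset.univ) Finset.univ_nonempty
    (abs_expect_sub_expect_le F G)
  exact ⟨i, hi⟩

theorem expect_prod {ι κ : Type*} [Fintype ι] [Fintype κ] (F : ι × κ → ℝ) :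
    𝔼 p, F p = 𝔼 i, 𝔼 j, F (i, j) := by
  rw [← Finset.univ_product_univ, Finset.expect_product]

/-! ### Random functions -/

/-- The values of a random function at different points are independent and uniform, and remain so
after the application of bijections. -/
theorem expect_apply_injective {ι D X : Type*} [Fintype ι] [DecidableEq ι] [Fintype D]
    [DecidableEq D] [Fintype X] [Nonempty X] {a : ι → D} (ha : Function.Injective a)
    {u : ι → X → X} (hu : ∀ i, Function.Bijective (u i)) (ψ : (ι → X) → ℝ) :
    𝔼 h : D → X, ψ (fun i => u i (h (a i))) = 𝔼 z : ι → X, ψ z := by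
  classical
  let e : (D → X) ≃ (ι → X) × ({d // ¬ d ∈ Set.range a} → X) :=
    (Equiv.piEquivPiSubtypeProd (· ∈ Set.range a) fun _ => X).trans
      (Equiv.prodCongr (((Equiv.ofInjective a ha).arrowCongr (Equiv.refl X)).symm.trans
        (Equiv.piCongrRight fun i => Equiv.ofBijective (u i) (hu i))) (Equiv.refl _))
  refine (Fintype.expect_equiv e _ (fun p => ψ p.1) fun h => rfl).trans ?_
  rw [expect_prod]
  exact Finset.expect_congr rfl fun z _ => Fintype.expect_const (ψ z)

theorem expect_apply_eq_apply {D X : Type*} [Fintype D] [DecidableEq D] [Fintype X] [DecidableEq X]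
    [Nonempty X] {a b : D} (hab : a ≠ b) {u v : X → X} (hu : Function.Bijective u)
    (hv : Function.Bijective v) :
    𝔼 h : D → X, (if u (h a) = v (h b) then (1 : ℝ) else 0) = 1 / Fintype.card X := by
  have hinj : Function.Injective (fun i : Bool => if i then a else b) := by
    intro i j hij
    cases i <;> cases j <;> first | rfl | exact absurd hij hab | exact absurd hij hab.symm
  have h1 := expect_apply_injective hinj (u := fun i : Bool => if i then u else v)
    (by intro i; cases i; exacts [hv, hu]) (fun z => if z true = z false then (1 : ℝ) else 0)
  simp only [if_true, Bool.false_eq_true, if_false] at h1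
  rw [h1]
  refine (Fintype.expect_equiv (Equiv.boolArrowEquivProd X) _
    (fun p => if p.2 = p.1 then (1 : ℝ) else 0) fun z => rfl).trans ?_
  rw [expect_prod, ← Fintype.expect_const (ι := X) (1 / Fintype.card X : ℝ)]
  refine Finset.expect_congr rfl fun x _ => ?_
  rw [Fintype.expect_eq_sum_div_card]
  simp

/-- Union bound: random values any two of which collide with probability at most `p`. -/
theorem expect_not_injective_le {Ω ι X : Type*} [Fintype Ω] [Fintype ι] [DecidableEq ι]
    [DecidableEq X] (z : Ω → ι → X) {p : ℝ} (hp : 0 ≤ p)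
    (h : ∀ i j, i ≠ j → 𝔼 ω, (if z ω i = z ω j then (1 : ℝ) else 0) ≤ p)
    [DecidablePred fun ω => Function.Injective (z ω)] :
    𝔼 ω, (if Function.Injective (z ω) then (0 : ℝ) else 1) ≤ (Fintype.card ι : ℝ) ^ 2 * p := by
  calc 𝔼 ω, (if Function.Injective (z ω) then (0 : ℝ) else 1)
      ≤ 𝔼 ω, ∑ ij : ι × ι, if ij.1 ≠ ij.2 ∧ z ω ij.1 = z ω ij.2 then (1 : ℝ) else 0 := by
        refine Finset.expect_le_expect fun ω _ => ?_
        have h0 : ∀ ij ∈ (Finset.univ : Finset (ι × ι)),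
            (0 : ℝ) ≤ if ij.1 ≠ ij.2 ∧ z ω ij.1 = z ω ij.2 then (1 : ℝ) else 0 :=
          fun ij _ => by split_ifs <;> norm_num
        split_ifs with hinj
        · exact Finset.sum_nonneg h0
        · simp only [Function.Injective, not_forall] at hinj
          obtain ⟨i, j, hz, hij⟩ := hinj
          refine le_trans ?_ (Finset.single_le_sum h0 (Finset.mem_univ (i, j)))
          simp [hz, hij]
    _ = ∑ ij : ι × ι, 𝔼 ω, if ij.1 ≠ ij.2 ∧ z ω ij.1 = z ω ij.2 then (1 : ℝ) else 0 :=
        Finset.expect_sum_comm _ _ _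
    _ ≤ ∑ _ij : ι × ι, p := by
        refine Finset.sum_le_sum fun ij _ => ?_
        by_cases hij : ij.1 = ij.2
        · simpa [hij] using hp
        · simpa [hij] using h _ _ hij
    _ = (Fintype.card ι : ℝ) ^ 2 * p := by simp [sq]

/-! ### Three Feistel rounds with random functions -/

/-- The images of the states `s i` under three Feistel rounds, the first one with `c`. -/
def feistelOutputs {X ι : Type*} (xor : X → X → X) (s : ι → X × X) (a b c : X → X) : ι → X × X :=
  fun i => (feistel xor a ∘ feistel xor b ∘ feistel xor c) (s i)

/-- Two `[0, 1]`-valued random quantities that agree on an event have expectations which differ at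
most by the probability of the complementary event. -/
theorem abs_expect_sub_expect_le_of_eq {Ω : Type*} [Fintype Ω] (F G : Ω → ℝ) (good : Ω → Prop)
    [DecidablePred good] (hF : ∀ ω, F ω ∈ Set.Icc (0 : ℝ) 1) (hG : ∀ ω, G ω ∈ Set.Icc (0 : ℝ) 1)
    (h : ∀ ω, good ω → F ω = G ω) :
    |𝔼 ω, F ω - 𝔼 ω, G ω| ≤ 𝔼 ω, (if good ω then (0 : ℝ) else 1) := by
  refine (abs_expect_sub_expect_le F G).trans (Finset.expect_le_expect fun ω _ => ?_)
  split_ifs with hω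
  · simp [h ω hω]
  · rw [abs_le]
    constructor <;> linarith [(hF ω).1, (hF ω).2, (hG ω).1, (hG ω).2]

theorem expect_mem_Icc {Ω : Type*} [Fintype Ω] [Nonempty Ω] {F : Ω → ℝ}
    (hF : ∀ ω, F ω ∈ Set.Icc (0 : ℝ) 1) : 𝔼 ω, F ω ∈ Set.Icc (0 : ℝ) 1 :=
  ⟨Finset.expect_nonneg fun ω _ => (hF ω).1,
    Finset.expect_le Finset.univ_nonempty fun ω _ => (hF ω).2⟩

/-- The statistical core of the argument: after three Feistel rounds with independent random
functions, different inputs give outputs that are nearly uniform. The errors are the probabilities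
that the right halves after the first and the second round are not pairwise different. -/
theorem abs_expect_feistelOutputs_sub_le {X ι : Type*} [Fintype X] [DecidableEq X] [Nonempty X]
    [Fintype ι] [DecidableEq ι] {xor : X → X → X} (hxor : IsLatinSquare xor) {s : ι → X × X}
    (hs : Function.Injective s) (T : (ι → X × X) → Bool) :
    |𝔼 c : X → X, 𝔼 b : X → X, 𝔼 a : X → X, bitValue (T (feistelOutputs xor s a b c)) -
      𝔼 y : ι → X × X, bitValue (T y)| ≤ 2 * (Fintype.card ι : ℝ) ^ 2 / Fintype.card X := by
  classical
  have hbit : ∀ y, bitValue (T y) ∈ Set.Icc (0 : ℝ) 1 :=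
    fun y => ⟨bitValue_nonneg _, bitValue_le_one _⟩
  have hp : (0 : ℝ) ≤ 1 / Fintype.card X := by positivity
  -- The right halves after the first round.
  set M : (X → X) → ι → X := fun c i => xor (s i).1 (c (s i).2) with hM
  set ideal : ℝ := 𝔼 v : ι → X, 𝔼 z : ι → X, bitValue (T fun i => (v i, z i))
  have hy : 𝔼 y : ι → X × X, bitValue (T y) = ideal := by
    refine (Fintype.expect_equiv (Equiv.arrowProdEquivProdArrow ι (fun _ => X) fun _ => X) _
      (fun p => bitValue (T fun i => (p.1 i, p.2 i))) fun y => rfl).trans ?_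
    rw [expect_prod]
  have hcollM : 𝔼 c : X → X, (if Function.Injective (M c) then (0 : ℝ) else 1) ≤
      (Fintype.card ι : ℝ) ^ 2 * (1 / Fintype.card X) := by
    refine expect_not_injective_le M hp fun i j hij => ?_
    -- Different states with equal right halves have different left halves, and never collide.
    by_cases hR : (s i).2 = (s j).2
    · have hL : (s i).1 ≠ (s j).1 := fun hL => hij (hs (Prod.ext hL hR))
      refine (Finset.expect_eq_zero fun c _ => if_neg fun h => hL ?_).le.trans hp
      exact (hxor.2 (c (s i).2)).1 (by simpa [hM, hR] using h)
    · exact (expect_apply_eq_apply hR (hxor.1 _) (hxor.1 _)).le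
  have hcollN : 𝔼 v : ι → X, (if Function.Injective v then (0 : ℝ) else 1) ≤
      (Fintype.card ι : ℝ) ^ 2 * (1 / Fintype.card X) := by
    refine expect_not_injective_le (fun v => v) hp fun i j hij => ?_
    exact (expect_apply_eq_apply hij Function.bijective_id Function.bijective_id).le
  have hgood : ∀ c, Function.Injective (M c) →
      |𝔼 b : X → X, 𝔼 a : X → X, bitValue (T (feistelOutputs xor s a b c)) - ideal| ≤
        (Fintype.card ι : ℝ) ^ 2 * (1 / Fintype.card X) := by
    intro c hc
    have h1 := expect_apply_injective hc (u := fun i => xor (s i).2) (fun i => hxor.1 _)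
      (fun v => 𝔼 a : X → X, bitValue (T fun i => (v i, xor (M c i) (a (v i)))))
    have h2 : 𝔼 b : X → X, 𝔼 a : X → X, bitValue (T (feistelOutputs xor s a b c)) =
        𝔼 v : ι → X, 𝔼 a : X → X, bitValue (T fun i => (v i, xor (M c i) (a (v i)))) := h1
    rw [h2]
    refine (abs_expect_sub_expect_le_of_eq _ _ Function.Injective
      (fun v => expect_mem_Icc fun a => hbit _) (fun v => expect_mem_Icc fun z => hbit _)
      fun v hv => ?_).trans hcollN
    exact expect_apply_injective hv (u := fun i => xor (M c i)) (fun i => hxor.1 _)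
      (fun z => bitValue (T fun i => (v i, z i)))
  have hconst : 𝔼 _c : X → X, ideal = ideal := Fintype.expect_const _
  have hI : ideal ∈ Set.Icc (0 : ℝ) 1 :=
    expect_mem_Icc fun v => expect_mem_Icc fun z => hbit _
  rw [hy, ← hconst]
  calc _ ≤ 𝔼 c : X → X, |𝔼 b : X → X, 𝔼 a : X → X,
        bitValue (T (feistelOutputs xor s a b c)) - ideal| := abs_expect_sub_expect_le _ _
    _ ≤ 𝔼 c : X → X, ((if Function.Injective (M c) then (0 : ℝ) else 1) +
        (Fintype.card ι : ℝ) ^ 2 * (1 / Fintype.card X)) := by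
        refine Finset.expect_le_expect fun c _ => ?_
        split_ifs with hc
        · simpa using hgood c hc
        · have hF : 𝔼 b : X → X, 𝔼 a : X → X, bitValue (T (feistelOutputs xor s a b c)) ∈
              Set.Icc (0 : ℝ) 1 := expect_mem_Icc fun b => expect_mem_Icc fun a => hbit _
          have : (0 : ℝ) ≤ (Fintype.card ι : ℝ) ^ 2 * (1 / Fintype.card X) := by positivity
          rw [abs_le]
          constructor <;> linarith [hF.1, hF.2, hI.1, hI.2]
    _ ≤ (Fintype.card ι : ℝ) ^ 2 * (1 / Fintype.card X) +
        (Fintype.card ι : ℝ) ^ 2 * (1 / Fintype.card X) := by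
        rw [Finset.expect_add_distrib, Fintype.expect_const]
        gcongr
    _ = _ := by ring

end Expectation

/-! ### The states of the generator -/

theorem twoStepState_eq {X : Type*} [Fintype X] (star : X → ZMod (Fintype.card X) → X) (f : X → X)
    (x₀ : X) (i : ℕ) : (twoStepState star f x₀ i).2 =
      star (f (twoStepState star f x₀ i).1) (i : ZMod (Fintype.card X)) := by
  cases i <;> simp [twoStepState, twoStep, starHat]

/-- Within one period of the counter the states are pairwise different: if the first components of
two of them agree, then the second components were obtained from the same element with different
counter values. -/
theorem injective_twoStepState {X : Type*} [Fintype X] {star : X → ZMod (Fintype.card X) → X}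
    (hstar : IsLatinSquare star) (f : X → X) (x₀ : X) {q : ℕ} (hq : q ≤ Fintype.card X) :
    Function.Injective fun i : Fin q => twoStepState star f x₀ i := by
  intro i j hij
  have h2 := congrArg Prod.snd hij
  simp only at hij h2
  rw [twoStepState_eq, twoStepState_eq, ← hij] at h2
  have h3 := (hstar.1 _).1 h2
  rw [ZMod.natCast_eq_natCast_iff', Nat.mod_eq_of_lt (i.2.trans_le hq),
    Nat.mod_eq_of_lt (j.2.trans_le hq)] at h3
  exact Fin.ext h3

/-! ### Polynomially bounded and negligible sequences -/

section Asymptotics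

variable {n : ℕ → ℕ}

theorem tendsto_log_natCast (hn : Tendsto n atTop atTop) :
    Tendsto (fun l => Real.log (n l)) atTop atTop :=
  Real.tendsto_log_atTop.comp (tendsto_natCast_atTop_atTop.comp hn)

theorem PolyBounded.mono {p q : ℕ → ℕ} (hq : PolyBounded n q) (h : ∀ l, p l ≤ q l) :
    PolyBounded n p := by
  obtain ⟨c, hc⟩ := hq
  exact ⟨c, hc.mono fun l hl => (Nat.cast_le.2 (h l)).trans hl⟩

theorem PolyBounded.const (hn : Tendsto n atTop atTop) (m : ℕ) : PolyBounded n fun _ => m :=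
  ⟨1, by simpa using (tendsto_log_natCast hn).eventually_ge_atTop (m : ℝ)⟩

theorem PolyBounded.mul {p q : ℕ → ℕ} (hp : PolyBounded n p) (hq : PolyBounded n q) :
    PolyBounded n fun l => p l * q l := by
  obtain ⟨c, hc⟩ := hp
  obtain ⟨d, hd⟩ := hq
  refine ⟨c + d, ?_⟩
  filter_upwards [hc, hd] with l h1 h2
  rw [pow_add]
  push_cast
  exact mul_le_mul h1 h2 (Nat.cast_nonneg _) ((Nat.cast_nonneg _).trans h1)

theorem PolyBounded.add (hn : Tendsto n atTop atTop) {p q : ℕ → ℕ} (hp : PolyBounded n p)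
    (hq : PolyBounded n q) : PolyBounded n fun l => p l + q l := by
  obtain ⟨c, hc⟩ := hp
  obtain ⟨d, hd⟩ := hq
  refine ⟨max c d + 1, ?_⟩
  filter_upwards [hc, hd, (tendsto_log_natCast hn).eventually_ge_atTop 2] with l h1 h2 h3
  have h4 : (1 : ℝ) ≤ Real.log (n l) := by linarith
  push_cast
  calc (p l : ℝ) + q l ≤ Real.log (n l) ^ max c d + Real.log (n l) ^ max c d :=
        add_le_add (h1.trans (pow_le_pow_right₀ h4 (le_max_left _ _)))
          (h2.trans (pow_le_pow_right₀ h4 (le_max_right _ _)))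
    _ = Real.log (n l) ^ max c d * 2 := by ring
    _ ≤ Real.log (n l) ^ (max c d + 1) := by rw [pow_succ]; gcongr

theorem Negligible.mono {ε δ : ℕ → ℝ} (hδ : Negligible n δ) (h : ∀ᶠ l in atTop, ε l ≤ δ l) :
    Negligible n ε := fun c => by
  filter_upwards [hδ c, h] with l h1 h2 using h2.trans h1

theorem Negligible.add (hn : Tendsto n atTop atTop) {ε δ : ℕ → ℝ} (hε : Negligible n ε)
    (hδ : Negligible n δ) : Negligible n fun l => ε l + δ l := by
  intro c
  filter_upwards [hε (c + 1), hδ (c + 1), (tendsto_log_natCast hn).eventually_ge_atTop 2]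
    with l h1 h2 h3
  calc ε l + δ l ≤ 2 * (1 / Real.log (n l) ^ (c + 1)) := by linarith
    _ ≤ Real.log (n l) * (1 / Real.log (n l) ^ (c + 1)) := by gcongr
    _ = 1 / Real.log (n l) ^ c := by
      have : Real.log (n l) ≠ 0 := by linarith
      rw [pow_succ]
      field_simp

theorem eventually_log_pow_le (hn : Tendsto n atTop atTop) (c : ℕ) :
    ∀ᶠ l in atTop, Real.log (n l) ^ c ≤ n l := by
  have h := (Real.isLittleO_pow_log_id_atTop (n := c)).bound one_pos
  filter_upwards [(tendsto_natCast_atTop_atTop.comp hn).eventually h] with l hl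
  simpa using (le_abs_self _).trans hl

theorem PolyBounded.eventually_le (hn : Tendsto n atTop atTop) {q : ℕ → ℕ}
    (hq : PolyBounded n q) : ∀ᶠ l in atTop, q l ≤ n l := by
  obtain ⟨c, hc⟩ := hq
  filter_upwards [hc, eventually_log_pow_le hn c] with l h1 h2
  exact_mod_cast h1.trans h2

theorem PolyBounded.negligible_div (hn : Tendsto n atTop atTop) {q : ℕ → ℕ}
    (hq : PolyBounded n q) : Negligible n fun l => (q l : ℝ) / n l := by
  intro d
  obtain ⟨c, hc⟩ := hq
  filter_upwards [hc, eventually_log_pow_le hn (c + d),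
    (tendsto_log_natCast hn).eventually_gt_atTop 0, hn.eventually_gt_atTop 0] with l h1 h2 h3 h4
  have h5 : (0 : ℝ) < n l := Nat.cast_pos.2 h4
  rw [div_le_div_iff₀ h5 (pow_pos h3 d), one_mul]
  calc (q l : ℝ) * Real.log (n l) ^ d ≤ Real.log (n l) ^ c * Real.log (n l) ^ d := by gcongr
    _ = Real.log (n l) ^ (c + d) := (pow_add _ _ _).symm
    _ ≤ n l := h2

end Asymptotics

/-! ### The hybrid argument -/

section Hybrid

open Finset BigOperators

/-- Whatever the class of adversaries is, a test `T` of the outputs has a negligible advantage as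
soon as the tests derived from it in the following ways are admissible: the test of the keys that
computes the outputs itself, and the tests that use an unknown function in one of the three rounds,
with arbitrary fixed functions in the rounds before it and arbitrary fixed keys in the rounds
after it. -/
theorem negligible_advantage_twoStepOutputs {X K : ℕ → Type*} {n : ℕ → ℕ}
    [∀ l, Fintype (X l)] [∀ l, DecidableEq (X l)] [∀ l, Nonempty (X l)]
    [∀ l, Fintype (K l)] [∀ l, Nonempty (K l)]
    (hn : ∀ l, n l = Fintype.card (X l)) (hn_top : Tendsto n atTop atTop)
    {star : ∀ l, X l → ZMod (Fintype.card (X l)) → X l} (hstar : ∀ l, IsLatinSquare (star l))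
    {xor : ∀ l, X l → X l → X l} (hxor : ∀ l, IsLatinSquare (xor l))
    {g : ∀ l, K l → X l → X l} {keys : ∀ l, PMF (K l × K l × K l)}
    {𝒯g : Set (∀ l, (X l → X l) → Bool)} {𝒯k : Set (∀ l, K l × K l × K l → Bool)}
    (hg : Pseudorandom n 𝒯g fun l => (PMF.uniformOfFintype (K l)).map (g l))
    (hkeys : Pseudorandom n 𝒯k keys)
    {f : ∀ l, X l → X l} {x₀ : ∀ l, X l} {q : ℕ → ℕ} (hq : PolyBounded n q)
    (T : ∀ l, (Fin (q l) → X l × X l) → Bool)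
    (out : ∀ l, (X l → X l) → (X l → X l) → (X l → X l) → Fin (q l) → X l × X l)
    (hout : ∀ l, out l =
      feistelOutputs (xor l) fun i : Fin (q l) => twoStepState (star l) (f l) (x₀ l) i)
    (h0 : (fun l k => T l (out l (g l k.1) (g l k.2.1) (g l k.2.2))) ∈ 𝒯k)
    (h3 : ∀ k₁ k₂ : ∀ l, K l, (fun l h => T l (out l (g l (k₁ l)) (g l (k₂ l)) h)) ∈ 𝒯g)
    (h2 : ∀ (k₁ : ∀ l, K l) (c : ∀ l, X l → X l),
      (fun l h => T l (out l (g l (k₁ l)) h (c l))) ∈ 𝒯g)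
    (h1 : ∀ b c : ∀ l, X l → X l, (fun l h => T l (out l h (b l) (c l))) ∈ 𝒯g) :
    Negligible n fun l =>
      |acceptProb ((keys l).map
          (twoStepOutputs (star l) (xor l) (g l) (f l) (x₀ l) (q l))) (T l) -
        acceptProb (PMF.uniformOfFintype (Fin (q l) → X l × X l)) (T l)| := by
  -- The acceptance probability, as a function of the three round functions.
  set V : ∀ l, (X l → X l) → (X l → X l) → (X l → X l) → ℝ :=
    fun l a b c => bitValue (T l (out l a b c)) with hV
  have hadv : ∀ Θ ∈ 𝒯g, Negligible n fun l =>
      |𝔼 k, bitValue (Θ l (g l k)) - 𝔼 h, bitValue (Θ l h)| := by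
    intro Θ hΘ
    simpa only [acceptProb_map, acceptProb_uniformOfFintype, Function.comp] using hg Θ hΘ
  -- The first function applied becomes random, for the keys `k₁`, `k₂` that are worst.
  have hstep3 : ∃ ε, Negligible n ε ∧ ∀ l, |𝔼 k₁, 𝔼 k₂, 𝔼 k₃, V l (g l k₁) (g l k₂) (g l k₃) -
      𝔼 k₁, 𝔼 k₂, 𝔼 c, V l (g l k₁) (g l k₂) c| ≤ ε l := by
    choose k₁ hk₁ using fun l => exists_abs_expect_sub_expect_le
      (fun k₁ => 𝔼 k₂, 𝔼 k₃, V l (g l k₁) (g l k₂) (g l k₃))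
      (fun k₁ => 𝔼 k₂, 𝔼 c, V l (g l k₁) (g l k₂) c)
    choose k₂ hk₂ using fun l => exists_abs_expect_sub_expect_le
      (fun k₂ => 𝔼 k₃, V l (g l (k₁ l)) (g l k₂) (g l k₃))
      (fun k₂ => 𝔼 c, V l (g l (k₁ l)) (g l k₂) c)
    exact ⟨_, hadv _ (h3 k₁ k₂), fun l => (hk₁ l).trans (hk₂ l)⟩
  have hstep2 : ∃ ε, Negligible n ε ∧ ∀ l, |𝔼 k₁, 𝔼 k₂, 𝔼 c, V l (g l k₁) (g l k₂) c -
      𝔼 k₁, 𝔼 c, 𝔼 b, V l (g l k₁) b c| ≤ ε l := by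
    choose k₁ hk₁ using fun l => exists_abs_expect_sub_expect_le
      (fun k₁ => 𝔼 c, 𝔼 k₂, V l (g l k₁) (g l k₂) c)
      (fun k₁ => 𝔼 c, 𝔼 b, V l (g l k₁) b c)
    choose c hc using fun l => exists_abs_expect_sub_expect_le
      (fun c => 𝔼 k₂, V l (g l (k₁ l)) (g l k₂) c)
      (fun c => 𝔼 b, V l (g l (k₁ l)) b c)
    refine ⟨_, hadv _ (h2 k₁ c), fun l => ?_⟩
    have e : 𝔼 k₁, 𝔼 k₂, 𝔼 c, V l (g l k₁) (g l k₂) c =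
        𝔼 k₁, 𝔼 c, 𝔼 k₂, V l (g l k₁) (g l k₂) c :=
      Finset.expect_congr rfl fun k₁ _ => Finset.expect_comm _ _ _
    rw [e]
    exact (hk₁ l).trans (hc l)
  have hstep1 : ∃ ε, Negligible n ε ∧ ∀ l, |𝔼 k₁, 𝔼 c, 𝔼 b, V l (g l k₁) b c -
      𝔼 c, 𝔼 b, 𝔼 a, V l a b c| ≤ ε l := by
    choose c hc using fun l => exists_abs_expect_sub_expect_le
      (fun c => 𝔼 b, 𝔼 k₁, V l (g l k₁) b c)
      (fun c => 𝔼 b, 𝔼 a, V l a b c)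
    choose b hb using fun l => exists_abs_expect_sub_expect_le
      (fun b => 𝔼 k₁, V l (g l k₁) b (c l))
      (fun b => 𝔼 a, V l a b (c l))
    refine ⟨_, hadv _ (h1 b c), fun l => ?_⟩
    have e : 𝔼 k₁, 𝔼 c, 𝔼 b, V l (g l k₁) b c = 𝔼 c, 𝔼 b, 𝔼 k₁, V l (g l k₁) b c :=
      (Finset.expect_comm _ _ _).trans
        (Finset.expect_congr rfl fun c _ => Finset.expect_comm _ _ _)
    rw [e]
    exact (hc l).trans (hb l)
  obtain ⟨ε₃, hε₃, hstep3⟩ := hstep3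
  obtain ⟨ε₂, hε₂, hstep2⟩ := hstep2
  obtain ⟨ε₁, hε₁, hstep1⟩ := hstep1
  have hε₀ := hkeys _ h0
  have hstat : Negligible n fun l => ((2 * (q l * q l) : ℕ) : ℝ) / n l :=
    ((PolyBounded.const hn_top 2).mul (hq.mul hq)).negligible_div hn_top
  refine ((((hε₀.add hn_top hε₃).add hn_top hε₂).add hn_top hε₁).add hn_top hstat).mono ?_
  filter_upwards [hq.eventually_le hn_top] with l hl
  rw [hn] at hl
  have hinj := injective_twoStepState (hstar l) (f l) (x₀ l) hl
  have hLR := abs_expect_feistelOutputs_sub_le (hxor l) hinj (T l)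
  rw [← hout l] at hLR
  have e0 : acceptProb ((keys l).map
      (twoStepOutputs (star l) (xor l) (g l) (f l) (x₀ l) (q l))) (T l) =
      acceptProb (keys l) fun k => T l (out l (g l k.1) (g l k.2.1) (g l k.2.2)) := by
    rw [acceptProb_map, hout l]
    rfl
  have e1 : acceptProb (PMF.uniformOfFintype (K l × K l × K l))
      (fun k => T l (out l (g l k.1) (g l k.2.1) (g l k.2.2))) =
      𝔼 k₁, 𝔼 k₂, 𝔼 k₃, V l (g l k₁) (g l k₂) (g l k₃) := by
    rw [acceptProb_uniformOfFintype, expect_prod]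
    exact Finset.expect_congr rfl fun k₁ _ => expect_prod _
  have e2 : ((2 * (q l * q l) : ℕ) : ℝ) / n l =
      2 * (Fintype.card (Fin (q l)) : ℝ) ^ 2 / Fintype.card (X l) := by
    rw [hn l, Fintype.card_fin]
    push_cast
    ring
  have s3 := hstep3 l
  have s2 := hstep2 l
  have s1 := hstep1 l
  simp only [e0, e1, e2, acceptProb_uniformOfFintype (α := Fin (q l) → X l × X l)]
  rw [abs_le] at s1 s2 s3 hLR ⊢
  have s0 := abs_le.1 (le_refl |acceptProb (keys l)
    (fun k => T l (out l (g l k.1) (g l k.2.1) (g l k.2.2))) -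
      𝔼 k₁, 𝔼 k₂, 𝔼 k₃, V l (g l k₁) (g l k₂) (g l k₃)|)
  simp only [hV] at s0 s1 s2 s3 ⊢
  constructor <;> linarith [s0.1, s0.2, s1.1, s1.2, s2.1, s2.2, s3.1, s3.2, hLR.1, hLR.2]

end Hybrid

/-! ### Adversaries of unlimited computational power -/

namespace QueryAlg

/-- The algorithm that asks for the values at the given points and applies `k` to the answers. -/
def queryAll {A B : Type*} : (q : ℕ) → (Fin q → A) → ((Fin q → B) → Bool) → QueryAlg A B
  | 0, _, k => output (k Fin.elim0)
  | q + 1, a, k => query (a 0) fun b => queryAll q (fun i => a i.succ) fun z => k (Fin.cons b z)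

theorem queriesAtMost_queryAll {A B : Type*} (q : ℕ) (a : Fin q → A) (k : (Fin q → B) → Bool) :
    (queryAll q a k).QueriesAtMost q := by
  induction q with
  | zero => trivial
  | succ q ih => exact fun b => ih _ _

theorem run_queryAll {A B : Type*} (h : A → B) (q : ℕ) (a : Fin q → A)
    (k : (Fin q → B) → Bool) : (queryAll q a k).run h = k fun i => h (a i) := by
  induction q with
  | zero => exact congrArg k (funext fun i => i.elim0)
  | succ q ih =>
    refine (ih _ _).trans (congrArg k (funext fun i => ?_))
    refine Fin.cases ?_ (fun j => ?_) i <;> rfl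

end QueryAlg

/-- A test that uses an unknown function only at polynomially many points fixed in advance. -/
theorem mem_queryTests {n : ℕ → ℕ} {X : ℕ → Type*} {q : ℕ → ℕ} (hq : PolyBounded n q)
    (a : ∀ l, Fin (q l) → X l) (k : ∀ l, (Fin (q l) → X l) → Bool) :
    (fun l h => k l fun i => h (a l i)) ∈ queryTests n X :=
  ⟨q, hq, fun l => QueryAlg.queryAll (q l) (a l) (k l), fun _ =>
    ⟨QueryAlg.queriesAtMost_queryAll _ _ _, fun h => (QueryAlg.run_queryAll h _ _ _).symm⟩⟩

/-! ### Adversaries of polynomial size -/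

namespace BitEncoding

variable {X : Type*} (e : BitEncoding X)

theorem oracle_code (h : X → X) (x : X) : e.oracle h (e.code x) = e.code (h x) :=
  e.code_injective.extend_apply _ _ _

variable {Ω : Type*} {O : Ω → List Bool → List Bool} {I : Ω → List Bool} {s t : ℕ}

/-- Each half of the pair-valued quantity `p` can be computed in size `s`. -/
def PairComputable (O : Ω → List Bool → List Bool) (I : Ω → List Bool) (s : ℕ)
    (p : Ω → X × X) : Prop :=
  ComputableInSize O I s (fun ω => e.code (p ω).1) ∧
    ComputableInSize O I s fun ω => e.code (p ω).2

/-- In the setting of `ComputableInSize`, the value of the function `φ ω` at a point is obtained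
from the point at an additional cost of at most `t`. -/
def MapComputable (O : Ω → List Bool → List Bool) (I : Ω → List Bool) (t : ℕ)
    (φ : Ω → X → X) : Prop :=
  ∀ (s : ℕ) (x : Ω → X), ComputableInSize O I s (fun ω => e.code (x ω)) →
    ComputableInSize O I (s + t) fun ω => e.code (φ ω (x ω))

variable {e}

theorem PairComputable.const (p : X × X) : e.PairComputable O I e.len fun _ => p :=
  ⟨(ComputableInSize.const (e.code p.1)).mono (e.length_code _).le,
    (ComputableInSize.const (e.code p.2)).mono (e.length_code _).le⟩

theorem PairComputable.mono {p : Ω → X × X} (hp : e.PairComputable O I s p) (h : s ≤ t) :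
    e.PairComputable O I t p :=
  ⟨hp.1.mono h, hp.2.mono h⟩

theorem PairComputable.feistel {xor : X → X → X} {E : Circuit}
    (hE : ∀ a b, E.eval (e.code a ++ e.code b) = e.code (xor a b)) {p : Ω → X × X}
    (hp : e.PairComputable O I s p) {φ : Ω → X → X} (hφ : e.MapComputable O I t φ) :
    e.PairComputable O I (2 * s + (t + E.size + 1)) fun ω => feistel xor (φ ω) (p ω) := by
  refine ⟨hp.2.mono (by omega), ?_⟩
  have := (hp.1.append (hφ _ _ hp.2)).circuit E
  simp only [hE] at this
  exact this.mono (by omega)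

theorem MapComputable.oracle {I : (X → X) → List Bool} :
    e.MapComputable (fun h : X → X => e.oracle h) I (e.len + 1) id := by
  intro s x hx
  have := hx.query (m' := e.len) (fun ω => e.length_code _)
    fun ω => by rw [oracle_code, e.length_code]
  simpa only [oracle_code, add_assoc, id] using this

theorem MapComputable.mono {φ : Ω → X → X} (hφ : e.MapComputable O I s φ) (h : s ≤ t) :
    e.MapComputable O I t φ :=
  fun r x hx => (hφ r x hx).mono (by omega)

theorem MapComputable.keyed {K : Type*} {eK : BitEncoding K} {g : K → X → X} {E : Circuit}
    (hE : ∀ k x, E.eval (eK.code k ++ e.code x) = e.code (g k x)) {k : Ω → K}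
    (hk : ComputableInSize O I t fun ω => eK.code (k ω)) :
    e.MapComputable O I (t + E.size + 1) fun ω => g (k ω) := by
  intro s x hx
  have := (hk.append hx).circuit E
  simp only [hE] at this
  exact this.mono (by omega)

theorem computableInSize_pairSeqCode {q : ℕ} {y : Ω → Fin q → X × X}
    (hy : ∀ i, e.PairComputable O I s fun ω => y ω i) :
    ComputableInSize O I (q * (2 * s)) fun ω => e.pairSeqCode (y ω) := by
  have := ComputableInSize.flatten_ofFn fun i =>
    ((hy i).1.append (hy i).2).mono (two_mul s).ge
  refine (congrArg (ComputableInSize O I _) (funext fun ω => ?_)).mp this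
  rw [pairSeqCode, List.flatMap_def, List.map_ofFn]
  rfl

/-- A distinguisher `C` for the outputs, composed with a computation of the outputs. -/
theorem exists_circuit_test [Nonempty Ω] {q : ℕ} {y : Ω → Fin q → X × X}
    (hy : ∀ i, e.PairComputable O I s fun ω => y ω i) {N : ℕ} (hI : ∀ ω, (I ω).length = N)
    (C : Circuit) : ∃ D : Circuit, D.size ≤ q * (2 * s) + 2 * C.size + 1 ∧
      ∀ ω, D.evalWith (O ω) (I ω) = C.eval (e.pairSeqCode (y ω)) := by
  obtain ⟨D, h1, h2⟩ := ((computableInSize_pairSeqCode hy).circuit C).exists_circuit hI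
    fun ω => (List.length_map _ : _ = C.out.length)
  refine ⟨D, ?_, h2⟩
  have : C.out.length ≤ C.size := Nat.le_add_left _ _
  omega

end BitEncoding

/-- Membership in `oracleCircuitTests` from bounds for the costs of the halves of the outputs. -/
theorem mem_oracleCircuitTests {n : ℕ → ℕ} (hn : Tendsto n atTop atTop) {X : ℕ → Type*}
    [∀ l, Nonempty (X l)] {e : ∀ l, BitEncoding (X l)} {q s : ℕ → ℕ} (hq : PolyBounded n q)
    (hs : PolyBounded n s) {C : ℕ → Circuit} (hC : PolyBounded n fun l => (C l).size)
    {y : ∀ l, (X l → X l) → Fin (q l) → X l × X l}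
    (hy : ∀ l i, (e l).PairComputable (fun h => (e l).oracle h) (fun _ => []) (s l)
      fun h => y l h i) :
    (fun l h => decide ((C l).eval ((e l).pairSeqCode (y l h)) = [true])) ∈
      oracleCircuitTests n e := by
  choose D hD hD' using fun l => BitEncoding.exists_circuit_test (hy l) (N := 0) (fun _ => rfl) (C l)
  exact ⟨D, (((hq.mul ((PolyBounded.const hn 2).mul hs)).add hn
    ((PolyBounded.const hn 2).mul hC)).add hn (PolyBounded.const hn 1)).mono hD,
    fun l h => by rw [hD']⟩

theorem mem_circuitTests {n : ℕ → ℕ} (hn : Tendsto n atTop atTop) {X α : ℕ → Type*}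
    [∀ l, Nonempty (α l)] {e : ∀ l, BitEncoding (X l)} {q s : ℕ → ℕ} (hq : PolyBounded n q)
    (hs : PolyBounded n s) {C : ℕ → Circuit} (hC : PolyBounded n fun l => (C l).size)
    {code : ∀ l, α l → List Bool} {N : ℕ → ℕ} (hN : ∀ l a, (code l a).length = N l)
    {y : ∀ l, α l → Fin (q l) → X l × X l}
    (hy : ∀ l i, (e l).PairComputable (fun _ _ => []) (code l) (s l) fun a => y l a i) :
    (fun l a => decide ((C l).eval ((e l).pairSeqCode (y l a)) = [true])) ∈
      circuitTests n code := by
  choose D hD hD' using fun l => BitEncoding.exists_circuit_test (hy l) (hN l) (C l)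
  exact ⟨D, (((hq.mul ((PolyBounded.const hn 2).mul hs)).add hn
    ((PolyBounded.const hn 2).mul hC)).add hn (PolyBounded.const hn 1)).mono hD,
    fun l a => by beta_reduce; rw [← hD' l a]; rfl⟩

/-! ### Pseudorandomness of the output -/

theorem mainTheorem5 (X K : ℕ → Type*) (n : ℕ → ℕ)
    [∀ l, Fintype (X l)] [∀ l, DecidableEq (X l)] [∀ l, Nonempty (X l)]
    [∀ l, Fintype (K l)] [∀ l, Nonempty (K l)]
    (hn : ∀ l, n l = Fintype.card (X l)) (hn_top : Tendsto n atTop atTop)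
    (star : ∀ l, X l → ZMod (Fintype.card (X l)) → X l) (hstar : ∀ l, IsLatinSquare (star l))
    (xor : ∀ l, X l → X l → X l) (hxor : ∀ l, IsLatinSquare (xor l))
    (g : ∀ l, K l → X l → X l) (keys : ∀ l, PMF (K l × K l × K l)) :
    -- pseudorandomness against adversaries of unlimited computational power
    (Pseudorandom n (queryTests n X) (fun l => (PMF.uniformOfFintype (K l)).map (g l)) →
      Pseudorandom n Set.univ keys →
      ∀ (f : ∀ l, X l → X l) (x₀ : ∀ l, X l) (q : ℕ → ℕ), PolyBounded n q →
        Pseudorandom n Set.univ fun l =>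
          (keys l).map (twoStepOutputs (star l) (xor l) (g l) (f l) (x₀ l) (q l))) ∧
    -- pseudorandomness against adversaries of polynomial size
    (∀ (eX : ∀ l, BitEncoding (X l)) (eK : ∀ l, BitEncoding (K l)),
      PolyBounded n (fun l => (eX l).len) → PolyBounded n (fun l => (eK l).len) →
      EfficientlyComputable n eK eX eX g → EfficientlyComputable n eX eX eX xor →
      Pseudorandom n (oracleCircuitTests n eX)
        (fun l => (PMF.uniformOfFintype (K l)).map (g l)) →
      Pseudorandom n (circuitTests n fun l => (eK l).tripleCode) keys →
      ∀ (f : ∀ l, X l → X l) (x₀ : ∀ l, X l) (q : ℕ → ℕ), PolyBounded n q →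
        Pseudorandom n (circuitTests n fun l => (eX l).pairSeqCode (q := q l)) fun l =>
          (keys l).map (twoStepOutputs (star l) (xor l) (g l) (f l) (x₀ l) (q l))) := by
  constructor
  · intro hg hkeys f x₀ q hq T _
    refine negligible_advantage_twoStepOutputs hn hn_top hstar hxor hg hkeys hq T _
      (fun l => rfl) (Set.mem_univ _) (fun k₁ k₂ => ?_) (fun k₁ c => ?_) (fun b c => ?_)
    -- In each case the unknown function is used at the right halves that the already random
    -- functions produce from the states.
    · exact mem_queryTests hq (fun l i => (twoStepState (star l) (f l) (x₀ l) i).2)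
        fun l z => T l fun i => feistel (xor l) (g l (k₁ l)) (feistel (xor l) (g l (k₂ l))
          ((twoStepState (star l) (f l) (x₀ l) i).2,
            xor l (twoStepState (star l) (f l) (x₀ l) i).1 (z i)))
    · exact mem_queryTests hq
        (fun l i => (feistel (xor l) (c l) (twoStepState (star l) (f l) (x₀ l) i)).2)
        fun l z => T l fun i => feistel (xor l) (g l (k₁ l))
          ((feistel (xor l) (c l) (twoStepState (star l) (f l) (x₀ l) i)).2,
            xor l (feistel (xor l) (c l) (twoStepState (star l) (f l) (x₀ l) i)).1 (z i))
    · exact mem_queryTests hq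
        (fun l i => (feistel (xor l) (b l)
          (feistel (xor l) (c l) (twoStepState (star l) (f l) (x₀ l) i))).2)
        fun l z => T l fun i =>
          ((feistel (xor l) (b l)
            (feistel (xor l) (c l) (twoStepState (star l) (f l) (x₀ l) i))).2,
            xor l (feistel (xor l) (b l)
              (feistel (xor l) (c l) (twoStepState (star l) (f l) (x₀ l) i))).1 (z i))
  · rintro eX eK hX hK ⟨Eg, hEg, hg⟩ ⟨Ex, hEx, hx⟩ hprg hkeys f x₀ q hq T ⟨C, hC, hTC⟩
    obtain rfl : T = fun l y => decide ((C l).eval ((eX l).pairSeqCode y) = [true]) :=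
      funext fun l => funext fun y => hTC l y
    -- `t` bounds the cost of a value of a round function, which is obtained from a key or from
    -- an oracle; each round costs twice what its input costs, plus `d`.
    set t : ℕ → ℕ := fun l => (eX l).len + (eK l).len + (Eg l).size + 1 with ht
    set d : ℕ → ℕ := fun l => t l + (Ex l).size + 1 with hd
    set s : ℕ → ℕ := fun l => 8 * (eX l).len + 7 * d l with hs
    have htp : PolyBounded n t :=
      ((hX.add hn_top hK).add hn_top hEg).add hn_top (PolyBounded.const hn_top 1)
    have hsp : PolyBounded n s := ((PolyBounded.const hn_top 8).mul hX).add hn_top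
      ((PolyBounded.const hn_top 7).mul
        ((htp.add hn_top hEx).add hn_top (PolyBounded.const hn_top 1)))
    have hkey : ∀ l (k : K l), (eX l).MapComputable (fun h => (eX l).oracle h) (fun _ => []) (t l)
        fun _ : X l → X l => g l k := fun l k =>
      (BitEncoding.MapComputable.keyed (hg l)
        ((ComputableInSize.const ((eK l).code k)).mono ((eK l).length_code k).le)).mono
        (by simp only [ht]; omega)
    have horacle : ∀ l, (eX l).MapComputable (fun h => (eX l).oracle h) (fun _ => []) (t l) id :=
      fun l => BitEncoding.MapComputable.oracle.mono (by simp only [ht]; omega)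
    refine negligible_advantage_twoStepOutputs hn hn_top hstar hxor hprg hkeys hq _ _
      (fun l => rfl) ?_ (fun k₁ k₂ => ?_) (fun k₁ c => ?_) (fun b c => ?_)
    · refine mem_circuitTests hn_top hq hsp hC (N := fun l => (eK l).len + ((eK l).len + (eK l).len))
        (fun l k => by simp [BitEncoding.tripleCode, (eK l).length_code]) fun l i => ?_
      have hin : ∀ k : K l × K l × K l → K l,
          ComputableInSize (fun _ _ => []) (eK l).tripleCode 0 (fun ω => (eK l).code (k ω)) →
          (eX l).MapComputable (fun _ _ => []) (eK l).tripleCode (t l) fun ω => g l (k ω) :=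
        fun k hk => (BitEncoding.MapComputable.keyed (hg l) hk).mono (by simp only [ht]; omega)
      have h1 := hin (fun k => k.1) (ComputableInSize.input (a := fun _ => [])
        (c := fun k => (eK l).code k.2.1 ++ (eK l).code k.2.2) (fun k => rfl) (fun _ => rfl)
        fun k => (eK l).length_code _)
      have h2 := hin (fun k => k.2.1) (ComputableInSize.input (a := fun k => (eK l).code k.1)
        (c := fun k => (eK l).code k.2.2) (fun k => (List.append_assoc _ _ _).symm)
        (fun k => (eK l).length_code _) fun k => (eK l).length_code _)
      have h3 := hin (fun k => k.2.2) (ComputableInSize.input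
        (a := fun k => (eK l).code k.1 ++ (eK l).code k.2.1)
        (c := fun _ => []) (A := (eK l).len + (eK l).len)
        (fun k => by simp [BitEncoding.tripleCode])
        (fun k => by simp [(eK l).length_code]) fun k => (eK l).length_code _)
      exact ((((BitEncoding.PairComputable.const _).feistel (hx l) h3).feistel (hx l) h2).feistel
        (hx l) h1).mono (by simp only [hs, hd]; omega)
    · refine mem_oracleCircuitTests hn_top hq hsp hC fun l i => ?_
      exact ((((BitEncoding.PairComputable.const _).feistel (hx l) (horacle l)).feistel (hx l)
        (hkey l (k₂ l))).feistel (hx l) (hkey l (k₁ l))).mono (by simp only [hs, hd]; omega)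
    · refine mem_oracleCircuitTests hn_top hq hsp hC fun l i => ?_
      exact (((BitEncoding.PairComputable.const (feistel (xor l) (c l) _)).feistel (hx l)
        (horacle l)).feistel (hx l) (hkey l (k₁ l))).mono (by simp only [hs, hd]; omega)
    · refine mem_oracleCircuitTests hn_top hq hsp hC fun l i => ?_
      exact ((BitEncoding.PairComputable.const
        (feistel (xor l) (b l) (feistel (xor l) (c l) _))).feistel (hx l) (horacle l)).mono
        (by simp only [hs, hd]; omega)
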